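/- **Definitions.** Let $L\subset S^3$ be a link and $k\ge 0$. A *$D^k$-surface* for $L$ is a compact surface $F\subset S^3$ with $\partial F=L$, decorated with $k$ disjoint crosscuts (properly embedded arcs), which are directed, ordered, and each labeled active or inactive, and with dots on its facets (the components of $F$ minus the crosscuts), such that the following holds for its *cross-dual* $F^{\mathrm{cd}}$, the surface obtained by cutting $F$ along each crosscut and inserting a piece with a right-handed half twist (active crosscut) or a left-handed half twist (inactive crosscut), each piece being oriented so that its boundary orientation agrees with the direction of the cut crosscut: $F^{\mathrm{cd}}$ is orientable, and there are 3-balls $B^3_\pm\subset S^3$ meeting in their common boundary sphere $\Sigma=\partial B^3_+$ such that $\Sigma$ contains $\partial F^{\mathrm{cd}}$ and the inserted pieces, the orientations of the pieces agree with that of $\Sigma$, and the rest of $F^{\mathrm{cd}}$ lies in $B^3_+$. Isotopies of $D^k$-surfaces are ambient, preserve $L$ setwise and preserve all decorations; dots may move within facets. The gradings are $I=\mathrm{sig}(F)$ (signature of the Goeritz form $(a,a')\mapsto \mathrm{lk}(a,\tau a')$ on $H_1(F;\mathbb Q)$), $J=-\chi(F)-\mathrm{sig}(F)+2\#\{\text{dots}\}$,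 $K=k$ and $B=\mathrm{sig}(F)+\#\{\text{active crosscuts}\}$. Let $\mathcal C_{i,j,k,b}(L)$ be the free abelian group on the isotopy classes of $D^k$-surfaces for $L$ with $(I,J,K,B)=(i,j,k,b)$, and $B\mathcal C_{i,j,k,b}(L)$ its quotient by the Bar-Natan relations: (S0) a surface with an undotted sphere component is $0$; (S1) a once-dotted sphere component may be removed; (NC) if $\bar F$ is the result of compressing $F$ along a disk $D$ with $D\cap F=\partial D$ disjoint from the crosscuts, then $F$ is the sum of the two surfaces obtained by adding a dot to $\bar F$ on one or on the other copy of $D$; (D2) a surface with two or more dots on a facet is $0$. The differential $d: B\mathcal C_{i,j,k,b}\to B\mathcal C_{i+1,j,k,b}$ is $d(F)=\sum_c(-1)^{\alpha(c)}d_c(F)$, the sum over the active crosscuts $c$ of $F$, where $\alpha(c)$ is the number of inactive crosscuts before $c$ in the ordering. Here $d_c$ is the following local change. Around $c$, the surface is a left-handed half-twisted band between two strands of $L$, one above the other, with $c$ the vertical arc directed upwards from the lower to the upper strand; this band is removed, its two ends are joined by a saddle below both strands, and the saddle and the two strands are joined by a right-handed half-twisted band between the strands. The crosscut $c$ becomes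 an inactive crosscut across the new band, directed so that the orientation of the inserted piece in the cross-dual is unchanged. A Bar-Natan complex $B\mathcal C$ of $L$ *with certain orderings* is the complex generated as above by a set $\mathcal O$ of (ordered) $D^k$-surfaces that is closed under isotopy, under the maps $d_c$, and under the relations (S1) and (NC) between surfaces (for instance, all of them). For $\sigma\in S_k$ let $\sigma F$ be the surface $F$ with the crosscut in position $l$ moved to position $\sigma(l)$, and let $B\mathcal C'=\sigma B\mathcal C$ be the complex for $\sigma\mathcal O=\{\sigma F: F\in\mathcal O\}$. **Theorem.** Let $B\mathcal C$ be a Bar-Natan complex of the link $L$ with certain orderings of the crosscuts, let $\sigma\in S_k$, and let $B\mathcal C'=\sigma B\mathcal C$ be the complex in which the orderings have been permuted by $\sigma$. Then there is an isomorphism of chain complexes $\psi:B\mathcal C\to B\mathcal C'$ that preserves all gradings and sends the class of every $D^k$-surface $F$ to $\pm$ the class of $\sigma F$. If $\sigma=(m\ m{+}1)$ is an adjacent transposition, there is such a $\psi$ with $$\psi(F)=\begin{cases}-\sigma F&\text{if the crosscuts in positions } m \text{ and } m+1 \text{ of } F \text{ are both inactive},\\ \ \ \sigma F&\text{otherwise.}\end{cases}$$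 Moreover, with $\psi(F)=\varepsilon\,\sigma F$, $\varepsilon=\pm1$ the sign used above, $\psi$ takes every signed sum $\sum_c(-1)^{\alpha(c)}d_c(F)$ of local changes of $F$ to $\varepsilon$ times such a signed sum for $\sigma F$. -/

import Mathlib

open CategoryTheory

noncomputable section

namespace Diagramless

/-! ### The three-sphere and ambient isotopies -/

abbrev E3 : Type := EuclideanSpace ℝ (Fin 3)

/-- The three-sphere, as the one-point compactification of `ℝ³` (with the orientation of `ℝ³`). -/
abbrev S3 : Type := OnePoint E3

/-- The point of `ℝ³` with the given coordinates. -/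
def pt (x y z : ℝ) : E3 := !₂[x, y, z]

structure AmbientIsotopy where
  toFun : unitInterval → (S3 ≃ₜ S3)
  continuous_toFun : Continuous fun p : unitInterval × S3 => toFun p.1 p.2
  zero : toFun 0 = Homeomorph.refl S3

/-- `h` is the end of an ambient isotopy. Such an `h` is also used as a coordinate system on `S³`
(standard coordinates to actual position) in which a local picture is drawn. -/
def IsotopicToId (h : S3 ≃ₜ S3) : Prop := ∃ Φ : AmbientIsotopy, Φ.toFun 1 = h

/-! ### Links and (locally flat) surfaces in the three-sphere -/

/-- A link: a compact locally flat 1-submanifold of `S³` without boundary. -/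
def IsLink (L : Set S3) : Prop :=
  IsCompact L ∧ ∀ x ∈ L, ∃ φ : E3 → S3, Topology.IsOpenEmbedding φ ∧ φ 0 = x ∧
    φ ⁻¹' L = {v | v 1 = 0 ∧ v 2 = 0}

/-- `φ` is a chart of `S³` around `x` in which `F` is the plane `z = 0`. -/
def IsInteriorChart (F : Set S3) (x : S3) (φ : E3 → S3) : Prop :=
  Topology.IsOpenEmbedding φ ∧ φ 0 = x ∧ φ ⁻¹' F = {v | v 2 = 0}

/-- `φ` is a chart of `S³` around `x` in which `F` is the half-plane `z = 0, y ≥ 0`. -/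
def IsBoundaryChart (F : Set S3) (x : S3) (φ : E3 → S3) : Prop :=
  Topology.IsOpenEmbedding φ ∧ φ 0 = x ∧ φ ⁻¹' F = {v | v 2 = 0 ∧ 0 ≤ v 1}

/-- The boundary of a surface. -/
def bdry (F : Set S3) : Set S3 := {x | ∃ φ, IsBoundaryChart F x φ}

/-- A compact locally flat surface in `S³`, possibly with boundary, disconnected,
non-orientable or empty. -/
def IsCompactSurface (F : Set S3) : Prop :=
  IsCompact F ∧ ∀ x ∈ F, x ∈ bdry F ∨ ∃ φ, IsInteriorChart F x φ

def IsSphere (S : Set S3) : Prop := Nonempty (S ≃ₜ Metric.sphere (0 : E3) 1)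

/-- Orientability of a surface: its interior has an atlas all of whose coordinate changes are
differentiable with positive Jacobian determinant. -/
def IsOrientable (F : Set S3) : Prop :=
  ∃ A : Set (OpenPartialHomeomorph {x : S3 // x ∈ F ∧ x ∉ bdry F} (EuclideanSpace ℝ (Fin 2))),
    (∀ x, ∃ e ∈ A, x ∈ e.source) ∧
    ∀ e ∈ A, ∀ e' ∈ A, ∀ v ∈ (e.symm.trans e').source,
      ∃ f' : EuclideanSpace ℝ (Fin 2) →L[ℝ] EuclideanSpace ℝ (Fin 2),
        HasFDerivAt (e.symm.trans e') f' v ∧ 0 < f'.det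

/-! ### Euler characteristic and signature of a surface -/

/-- The Euler characteristic, through singular homology with rational coefficients. -/
def eulerChar (F : Set S3) : ℤ :=
  (((AlgebraicTopology.singularChainComplexFunctor (ModuleCat.{0} ℚ)).obj
    (ModuleCat.of ℚ ℚ)).obj (TopCat.of F)).homologyEulerChar

/-- First singular homology with rational coefficients. -/
abbrev H1 (X : Type) [TopologicalSpace X] : ModuleCat.{0} ℚ :=
  ((AlgebraicTopology.singularHomologyFunctor (ModuleCat.{0} ℚ) 1).obj
    (ModuleCat.of ℚ ℚ)).obj (TopCat.of X)

def H1map {X Y : Type} [TopologicalSpace X] [TopologicalSpace Y] (f : C(X, Y)) :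
    H1 X →ₗ[ℚ] H1 Y :=
  (((AlgebraicTopology.singularHomologyFunctor (ModuleCat.{0} ℚ) 1).obj
    (ModuleCat.of ℚ ℚ)).map (TopCat.ofHom f)).hom

/-- Gauss' linking integral of two closed curves of period `1` in `ℝ³`. -/
def gaussIntegral (a b : ℝ → E3) : ℝ :=
  1 / (4 * Real.pi) * ∫ s in (0 : ℝ)..1, ∫ t in (0 : ℝ)..1,
    Matrix.det (Matrix.of ![(fun i => (a s - b t) i : Fin 3 → ℝ),
      (fun i => (deriv a s) i), (fun i => (deriv b t) i)]) / ‖a s - b t‖ ^ 3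

/-- `n` is the linking number of the disjoint loops `α`, `β` (of period `1`) in `S³`:
the Gauss integral of any `C¹` pair of loops in `ℝ³` to which the pair can be deformed
while the two loops are kept disjoint from each other. -/
def IsLinkingNumber (α β : ℝ → S3) (n : ℝ) : Prop :=
  ∃ A B : unitInterval → ℝ → S3, ∃ a b : ℝ → E3,
    (Continuous fun p : unitInterval × ℝ => A p.1 p.2) ∧
    (Continuous fun p : unitInterval × ℝ => B p.1 p.2) ∧
    (∀ τ, Function.Periodic (A τ) 1) ∧ (∀ τ, Function.Periodic (B τ) 1) ∧
    (∀ τ s t, A τ s ≠ B τ t) ∧ A 0 = α ∧ B 0 = β ∧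
    ContDiff ℝ 1 a ∧ ContDiff ℝ 1 b ∧
    (∀ s, A 1 s = (a s : S3)) ∧ (∀ t, B 1 t = (b t : S3)) ∧ n = gaussIntegral a b

/-- `N` is a strip (an annulus if `e = 1`, a Möbius strip if `e = -1`) normal to `F` along the
loop `b` of `F`: `N t 0 = b t`, and `N t s` lies off `F`, on one side of it for `s > 0` and on the
other side for `s < 0`. -/
structure IsNormalStrip (F : Set S3) (b : ℝ → S3) (e : ℤˣ) (N : ℝ → ℝ → S3) : Prop where
  continuous : Continuous fun p : ℝ × ℝ => N p.1 p.2
  zero : ∀ t, N t 0 = b t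
  off : ∀ t s, s ≠ 0 → N t s ∉ F
  sides : ∀ t, ∃ φ, IsInteriorChart F (b t) φ ∧
    ∀ᶠ s in nhds (0 : ℝ), ∃ v, φ v = N t s ∧ SignType.sign (v 2) = SignType.sign s
  closes : ∀ t s, N (t + 1) s = N t (((e : ℤ) : ℝ) * s)

/-- `n = lk(a, τ b)`, where `τ b` is the pushoff of `2b` into the complement of `F`: the two
parallel copies of `b` on the two sides of `F`, which are two loops if the sides are not
interchanged along `b`, and otherwise form one loop that runs twice along `b`. -/
def IsPushoffLinking (F : Set S3) (a b : ℝ → S3) (n : ℝ) : Prop :=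
  (∃ N m m', IsNormalStrip F b 1 N ∧ IsLinkingNumber a (fun t => N t 1) m ∧
    IsLinkingNumber a (fun t => N t (-1)) m' ∧ n = m + m') ∨
  (∃ N, IsNormalStrip F b (-1) N ∧ IsLinkingNumber a (fun t => N (2 * t) 1) n)

/-- The number of positive minus the number of negative eigenvalues of a matrix. -/
def matrixSignature {n : ℕ} (G : Matrix (Fin n) (Fin n) ℝ) : ℤ :=
  ((G.charpoly.roots.filter (0 < ·)).card : ℤ) - ((G.charpoly.roots.filter (· < 0)).card : ℤ)

/-- `s` is the signature of the surface `F`, i.e. the signature of a Goeritz matrix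
`lk(a i, τ (a j))`, where the loops `a i` in the interior of `F` form a basis of `H₁(F; ℚ)`.
(`γ` is the class of the circle, up to a rational factor.) -/
def HasSignature (F : Set S3) (s : ℤ) : Prop :=
  ∃ (n : ℕ) (a : Fin n → C(UnitAddCircle, F)) (γ : H1 UnitAddCircle)
    (G : Matrix (Fin n) (Fin n) ℝ),
    (∀ i t, (a i t : S3) ∉ bdry F) ∧
    LinearIndependent ℚ (fun i => H1map (a i) γ) ∧
    Submodule.span ℚ (Set.range fun i => H1map (a i) γ) = ⊤ ∧
    (∀ i j, IsPushoffLinking F (fun t => (a i (t : UnitAddCircle) : S3))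
      (fun t => (a j (t : UnitAddCircle) : S3)) (G i j)) ∧
    s = matrixSignature G

/-! ### Surfaces with ordered, oriented, active or inactive crosscuts and with dots -/

/-- The data of a surface in `S³` with `k` ordered crosscuts. The crosscut in position `l` is an
arc, directed from `arc l 0` to `arc l 1`; it is active or inactive. The surface carries
`dots p` dots at the point `p`. -/
structure CrosscutSurface (k : ℕ) where
  carrier : Set S3
  arc : Fin k → C(unitInterval, S3)
  active : Fin k → Bool
  dots : S3 →₀ ℕ

namespace CrosscutSurface

variable {k : ℕ}

/-- The underlying set of a crosscut. -/
def cut (F : CrosscutSurface k) (l : Fin k) : Set S3 := Set.range (F.arc l)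

/-- The surface without its crosscuts. -/
def uncut (F : CrosscutSurface k) : Set S3 := F.carrier \ ⋃ l, F.cut l

/-- The facet that contains the point `x` of `F.uncut`. -/
def facet (F : CrosscutSurface k) (x : S3) : Set S3 := connectedComponentIn F.uncut x

open Classical in
/-- The number of dots on the facet that contains `x`. -/
def dotCount (F : CrosscutSurface k) (x : S3) : ℕ :=
  (F.dots.filter (· ∈ F.facet x)).sum fun _ n => n

/-- The total number of dots. -/
def totalDots (F : CrosscutSurface k) : ℕ := F.dots.sum fun _ n => n

def numActive (F : CrosscutSurface k) : ℕ := Fintype.card {l // F.active l = true}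

/-- The same surface with its crosscuts reordered: the crosscut in position `l` is moved to
position `σ l`. -/
def reorder (σ : Equiv.Perm (Fin k)) (F : CrosscutSurface k) : CrosscutSurface k where
  carrier := F.carrier
  arc := F.arc ∘ σ.symm
  active := F.active ∘ σ.symm
  dots := F.dots

/-- A compact surface with boundary `L`, with disjoint crosscuts (properly embedded arcs),
and with dots on its facets. -/
structure IsDecorated (L : Set S3) (F : CrosscutSurface k) : Prop where
  surface : IsCompactSurface F.carrier
  boundary : bdry F.carrier = L
  injective : ∀ l, Function.Injective (F.arc l)
  cut_subset : ∀ l, F.cut l ⊆ F.carrier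
  proper : ∀ l, F.cut l ∩ L = {F.arc l 0, F.arc l 1}
  disjoint : ∀ l l', l ≠ l' → Disjoint (F.cut l) (F.cut l')
  dots_subset : ∀ p, F.dots p ≠ 0 → p ∈ F.uncut

end CrosscutSurface

/-! ### Local pictures -/

/-- The ball of `S³` in which the local picture with coordinates `h` is drawn. -/
def window (h : S3 ≃ₜ S3) : Set S3 := {p | ∃ v : E3, ‖v‖ ≤ 3 ∧ p = h v}

/-- In the coordinates `h`, the part of `F` in the window is the given picture. -/
def Looks (h : S3 ≃ₜ S3) (F : Set S3) (picture : Set E3) : Prop :=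
  ∀ v : E3, ‖v‖ ≤ 3 → (h v ∈ F ↔ v ∈ picture)

/-- `F` and `G` agree outside the window. -/
def AgreeOff (h : S3 ≃ₜ S3) (F G : Set S3) : Prop := ∀ p, p ∉ window h → (p ∈ F ↔ p ∈ G)

/-! ### The cross-dual -/

/-- A flat band along the `y`-axis. -/
def flatBand : Set E3 := {v | v 2 = 0 ∧ |v 0| ≤ 1}

/-- The angle by which the twisted band has turned at height `y`: it grows from `0` at `y = -1/2`
to `π` at `y = 1/2`. -/
def twistAngle (y : ℝ) : ℝ := Real.pi * max 0 (min 1 (y + 1 / 2))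

/-- The point of the band along the `y`-axis with a half twist between `y = -1/2` and `y = 1/2`,
at signed distance `r` from the axis. The twist is right-handed for `right = true` (the band turns
by the right-hand rule, from `x` to `-z`, when one moves along `y`) and else left-handed. -/
def twistPoint (right : Bool) (r y : ℝ) : E3 :=
  pt (r * Real.cos (twistAngle y)) y ((if right then -1 else 1) * (r * Real.sin (twistAngle y)))

def twistedBand (right : Bool) : Set E3 := {v | ∃ r, |r| ≤ 1 ∧ v = twistPoint right r (v 1)}

/-- Coordinates around each of the crosscuts, with disjoint windows, in which the surface is a
flat band and the crosscut is the segment from `(-1,0,0)` to `(1,0,0)` across it. -/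
structure FlatCoordinates {k : ℕ} (F : CrosscutSurface k) where
  h : Fin k → (S3 ≃ₜ S3)
  isotopic : ∀ l, IsotopicToId (h l)
  disjoint : ∀ l l', l ≠ l' → Disjoint (window (h l)) (window (h l'))
  looks : ∀ l, Looks (h l) F.carrier flatBand
  cut_eq : ∀ l, F.cut l = {p | ∃ x : ℝ, |x| ≤ 1 ∧ p = h l (pt x 0 0)}
  start : ∀ l, F.arc l 0 = h l (pt (-1) 0 0)

namespace FlatCoordinates

variable {k : ℕ} {F : CrosscutSurface k}

/-- The cross-dual: cut along each crosscut, and insert a right-handed half twist at the active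
and a left-handed half twist at the inactive crosscuts. -/
def crossDual (D : FlatCoordinates F) : Set S3 :=
  {p | (p ∈ F.carrier ∧ ∀ l, p ∉ window (D.h l)) ∨
    ∃ l, ∃ v : E3, ‖v‖ ≤ 3 ∧ v ∈ twistedBand (F.active l) ∧ p = D.h l v}

/-- The inserted piece at the crosscut `l`, as a map of the rectangle `|r| ≤ 1, |y| ≤ 1/2`.
Its local orientation is the image of the orientation of the `(r,y)`-plane. With it, the
counterclockwise boundary runs along both (cut) crosscut sites `y = ∓ 1/2` in the
direction of the crosscut. -/
def piece (D : FlatCoordinates F) (l : Fin k) (r y : ℝ) : S3 :=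
  D.h l (twistPoint (F.active l) r y)

def pieceSet (D : FlatCoordinates F) (l : Fin k) : Set S3 :=
  {p | ∃ r y : ℝ, |r| ≤ 1 ∧ |y| ≤ 1 / 2 ∧ p = D.piece l r y}

def skeleton (D : FlatCoordinates F) : Set S3 := bdry D.crossDual ∪ ⋃ l, D.pieceSet l

end FlatCoordinates

/-- The standard 2-sphere in `S³`: the plane `z = 0` and the point at infinity. It is oriented
as the `(x,y)`-plane. -/
def stdSphere : Set S3 := {p | p = OnePoint.infty ∨ ∃ v : E3, v 2 = 0 ∧ p = v}

/-- The standard lower ball. The orientation of `stdSphere` is its boundary orientation. -/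
def stdLowerBall : Set S3 := {p | p = OnePoint.infty ∨ ∃ v : E3, v 2 ≤ 0 ∧ p = v}

/-- A map of the rectangle into `S³` is an embedding into the standard sphere that preserves the
orientation, i.e. it is isotopic, through embeddings into the sphere, to the inclusion of the
rectangle in the `(x,y)`-plane. -/
def IsPositiveInStdSphere (q : ℝ → ℝ → S3) : Prop :=
  ∃ H : unitInterval × (Set.Icc (-1 : ℝ) 1 × Set.Icc (-(1 / 2) : ℝ) (1 / 2)) → S3,
    Continuous H ∧ (∀ t, Function.Injective fun x => H (t, x)) ∧ (∀ x, H x ∈ stdSphere) ∧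
    (∀ x, H (0, x) = ((pt x.1 x.2 0 : E3) : S3)) ∧ ∀ x, H (1, x) = q x.1 x.2

/-- A `D^k`-surface with boundary `L`: the cross-dual is orientable, and there is an embedded
oriented 2-sphere `Σ = w(stdSphere)`, the common boundary of the balls `B³₊ = w(stdLowerBall)` and
`B³₋`, that contains the skeleton, with which the local orientations of the
inserted pieces agree, and such that the facets of the cross-dual lie in `B³₊`. -/
def IsDkSurface {k : ℕ} (L : Set S3) (F : CrosscutSurface k) : Prop :=
  F.IsDecorated L ∧ ∃ D : FlatCoordinates F, IsOrientable D.crossDual ∧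
    ∃ w : S3 ≃ₜ S3, IsotopicToId w ∧ D.skeleton ⊆ w '' stdSphere ∧
      (∀ l, IsPositiveInStdSphere fun r y => w.symm (D.piece l r y)) ∧
      D.crossDual \ D.skeleton ⊆ w '' stdLowerBall

/-- The values of the gradings: `i = I = sig`, `j = J = -χ - sig + 2δ` and
`b = B = sig + #(active crosscuts)`. (The grading `K` is `k`.) -/
def HasGrading {k : ℕ} (F : CrosscutSurface k) (i j b : ℤ) : Prop :=
  HasSignature F.carrier i ∧ j = -eulerChar F.carrier - i + 2 * (F.totalDots : ℤ) ∧
    b = i + (F.numActive : ℤ)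

/-- Isotopy of surfaces with boundary `L`, with all decorations. Dots may move within a facet. -/
def Isotopic {k : ℕ} (L : Set S3) (F G : CrosscutSurface k) : Prop :=
  ∃ Φ : AmbientIsotopy, (∀ t, Φ.toFun t '' L = L) ∧
    Φ.toFun 1 '' F.carrier = G.carrier ∧
    (∀ l, Φ.toFun 1 '' F.cut l = G.cut l) ∧
    (∀ l, Φ.toFun 1 (F.arc l 0) = G.arc l 0) ∧
    (∀ l, F.active l = G.active l) ∧
    ∀ x ∈ F.uncut, F.dotCount x = G.dotCount (Φ.toFun 1 x)

/-! ### The local differential -/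

/-- The left-handed half-twisted band between the lines `z = 1, y = 0` and `z = -1, x = 0`. -/
def activePicture : Set E3 := {v | |v 2| ≤ 1 ∧ v 0 * (1 - v 2) + v 1 * (1 + v 2) = 0}

/-- The result of the local differential, with the same boundary lines. Outside of the cylinder
`x² + y² = 1` nothing has changed, and inside there is now a right-handed half-twisted band
between the two boundary lines. The two bands are joined by the part of the cylinder between their
edges and below the band, which is closed by a disk at the bottom `z = -2`. Thus the two
outer parts are connected below the new band. -/
def differentialPicture : Set E3 :=
  {v | 1 ≤ v 0 ^ 2 + v 1 ^ 2 ∧ v ∈ activePicture} ∪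
  {v | v 0 ^ 2 + v 1 ^ 2 ≤ 1 ∧ |v 2| ≤ 1 ∧ v 0 * (1 - v 2) - v 1 * (1 + v 2) = 0} ∪
  {v | v 0 ^ 2 + v 1 ^ 2 = 1 ∧ |v 2| ≤ 1 ∧ |v 1| * (1 + v 2) ≤ |v 0| * (1 - v 2)} ∪
  {v | v 0 ^ 2 + v 1 ^ 2 = 1 ∧ -2 ≤ v 2 ∧ v 2 ≤ -1} ∪
  {v | v 0 ^ 2 + v 1 ^ 2 ≤ 1 ∧ v 2 = -2}

/-- The segment `|z| ≤ 1` of the `z`-axis, in the coordinates `h`. -/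
def axis (h : S3 ≃ₜ S3) : Set S3 := {p | ∃ z : ℝ, |z| ≤ 1 ∧ p = h (pt 0 0 z)}

/-- `G = d_c(F)`: around the active crosscut `c`, which points upwards, the surface is changed as
in the pictures, and `c` becomes the inactive crosscut of the new band (directed such that the
local orientation at `c` in the cross-dual does not change). -/
def IsLocalDifferential {k : ℕ} (F : CrosscutSurface k) (c : Fin k) (G : CrosscutSurface k) :
    Prop :=
  F.active c = true ∧ G.active = Function.update F.active c false ∧
  ∃ h : S3 ≃ₜ S3, IsotopicToId h ∧
    Looks h F.carrier activePicture ∧ Looks h G.carrier differentialPicture ∧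
    AgreeOff h F.carrier G.carrier ∧
    F.cut c = axis h ∧ F.arc c 0 = h (pt 0 0 (-1)) ∧
    G.cut c = axis h ∧ G.arc c 0 = h (pt 0 0 1) ∧
    (∀ l, l ≠ c → G.arc l = F.arc l ∧ Disjoint (F.cut l) (window h)) ∧
    G.dots = F.dots ∧ ∀ p ∈ window h, F.dots p = 0

/-! ### The Bar-Natan skein relations -/

/-- (S0) An undotted sphere is a component of `F`. -/
def HasUndottedSphere {k : ℕ} (F : CrosscutSurface k) : Prop :=
  ∃ S ⊆ F.carrier, IsSphere S ∧ IsClosed (F.carrier \ S) ∧ (∀ l, Disjoint (F.cut l) S) ∧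
    ∀ p ∈ S, F.dots p = 0

/-- (S1) `G` is the disjoint union of `F` and a once-dotted sphere. -/
def IsUnionWithDottedSphere {k : ℕ} (F G : CrosscutSurface k) : Prop :=
  ∃ (S : Set S3) (p : S3), IsSphere S ∧ Disjoint S F.carrier ∧ p ∈ S ∧
    G.carrier = F.carrier ∪ S ∧ G.arc = F.arc ∧ G.active = F.active ∧
    G.dots = F.dots + Finsupp.single p 1

/-- An annulus around the disk `x² + y² ≤ 1, z = 0`. -/
def neckPicture : Set E3 := {v | v 0 ^ 2 + v 1 ^ 2 = 1}

/-- The result of compressing the annulus along the disk. -/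
def cutNeckPicture : Set E3 :=
  {v | v 0 ^ 2 + v 1 ^ 2 = 1 ∧ 1 ≤ |v 2|} ∪ {v | v 0 ^ 2 + v 1 ^ 2 ≤ 1 ∧ |v 2| = 1}

/-- (NC) `G₁` and `G₂` arise from `F` by compression along a disk away from the crosscuts and an
additional dot on the one or on the other side of the disk. -/
def IsNeckCutting {k : ℕ} (F G₁ G₂ : CrosscutSurface k) : Prop :=
  ∃ h : S3 ≃ₜ S3, IsotopicToId h ∧ Looks h F.carrier neckPicture ∧
    Looks h G₁.carrier cutNeckPicture ∧ AgreeOff h F.carrier G₁.carrier ∧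
    G₂.carrier = G₁.carrier ∧
    (∀ l, Disjoint (F.cut l) (window h)) ∧ (∀ p ∈ window h, F.dots p = 0) ∧
    G₁.arc = F.arc ∧ G₂.arc = F.arc ∧ G₁.active = F.active ∧ G₂.active = F.active ∧
    G₁.dots = F.dots + Finsupp.single (h (pt 0 0 (-1))) 1 ∧
    G₂.dots = F.dots + Finsupp.single (h (pt 0 0 1)) 1

/-- (D2) Some facet carries at least two dots. -/
def HasTwiceDottedFacet {k : ℕ} (F : CrosscutSurface k) : Prop :=
  ∃ x ∈ F.uncut, 2 ≤ F.dotCount x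

/-! ### The Bar-Natan complex -/

/-- A choice of the orderings that are used: a set of (ordered) `D^k`-surfaces that is closed
under isotopy, under the local differentials and under the skein relations. It may be everything,
or it may, for instance, contain each surface with certain orderings of its crosscuts only. -/
structure IsOrderingFamily {k : ℕ} (L : Set S3) (𝒪 : Set (CrosscutSurface k)) : Prop where
  isotopic : ∀ F G, IsDkSurface L F → IsDkSurface L G → Isotopic L F G → F ∈ 𝒪 → G ∈ 𝒪
  differential : ∀ F c G, IsDkSurface L F → IsDkSurface L G → IsLocalDifferential F c G →
    F ∈ 𝒪 → G ∈ 𝒪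
  sphere : ∀ F G, IsDkSurface L F → IsDkSurface L G → IsUnionWithDottedSphere F G →
    (F ∈ 𝒪 ↔ G ∈ 𝒪)
  neck : ∀ F G₁ G₂, IsDkSurface L F → IsDkSurface L G₁ → IsDkSurface L G₂ →
    IsNeckCutting F G₁ G₂ → (F ∈ 𝒪 ↔ G₁ ∈ 𝒪) ∧ (F ∈ 𝒪 ↔ G₂ ∈ 𝒪)

/-- The orderings `𝒪`, all permuted by `σ`. -/
def permuteOrdering {k : ℕ} (σ : Equiv.Perm (Fin k)) (𝒪 : Set (CrosscutSurface k)) :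
    Set (CrosscutSurface k) :=
  CrosscutSurface.reorder σ '' 𝒪

section Complex

variable {k : ℕ} (L : Set S3) (𝒪 : Set (CrosscutSurface k)) (i j b : ℤ)

/-- The `D^k`-surfaces in `𝒪` with boundary `L` and gradings `i`, `j`, `k`, `b`. -/
def DkSurface : Type :=
  {F : CrosscutSurface k // F ∈ 𝒪 ∧ IsDkSurface L F ∧ HasGrading F i j b}

/-- The chain module: the free module on the isotopy classes of `D^k`-surfaces. -/
abbrev ChainModule : Type :=
  Quot (fun F G : DkSurface L 𝒪 i j b => Isotopic L F.1 G.1) →₀ ℤ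

variable {L 𝒪 i j b} in
/-- The generator of the chain module that is given by a surface. -/
def gen (F : DkSurface L 𝒪 i j b) : ChainModule L 𝒪 i j b := Finsupp.single (Quot.mk _ F) 1

/-- The submodule generated by the Bar-Natan skein relations. -/
def relations : Submodule ℤ (ChainModule L 𝒪 i j b) :=
  Submodule.span ℤ
    ({x | ∃ F : DkSurface L 𝒪 i j b, HasUndottedSphere F.1 ∧ x = gen F} ∪
     {x | ∃ F G : DkSurface L 𝒪 i j b, IsUnionWithDottedSphere F.1 G.1 ∧ x = gen F - gen G} ∪
     {x | ∃ F G₁ G₂ : DkSurface L 𝒪 i j b, IsNeckCutting F.1 G₁.1 G₂.1 ∧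
        x = gen F - gen G₁ - gen G₂} ∪
     {x | ∃ F : DkSurface L 𝒪 i j b, HasTwiceDottedFacet F.1 ∧ x = gen F})

/-- The Bar-Natan chain module. -/
abbrev BarNatanModule : Type := ChainModule L 𝒪 i j b ⧸ relations L 𝒪 i j b

variable {L 𝒪 i j b} in
/-- The class of a surface in the Bar-Natan chain module. -/
def cls (F : DkSurface L 𝒪 i j b) : BarNatanModule L 𝒪 i j b :=
  (relations L 𝒪 i j b).mkQ (gen F)

/-- `α(c)`, the number of inactive crosscuts before `c`. -/
def numInactiveBefore (F : CrosscutSurface k) (c : Fin k) : ℕ :=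
  Fintype.card {l : Fin k // l < c ∧ F.active l = false}

variable {L 𝒪 i j b} in
/-- `y` is the value `∑ (-1)^α(c) d_c(F)`, the sum over the active crosscuts `c` of `F`, of the
formula for the differential of `F`. -/
def IsSignedSum (F : DkSurface L 𝒪 i j b) (y : BarNatanModule L 𝒪 (i + 1) j b) : Prop :=
  ∃ G : {c : Fin k // F.1.active c = true} → DkSurface L 𝒪 (i + 1) j b,
    (∀ c, IsLocalDifferential F.1 c.1 (G c).1) ∧
    y = ∑ c, (-1 : ℤ) ^ numInactiveBefore F.1 c.1 • cls (G c)

/-- The maps `d i` satisfy `d(F) = ∑ (-1)^α(c) d_c(F)`, and `d ∘ d = 0`. -/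
def IsDifferential
    (d : ∀ i, BarNatanModule L 𝒪 i j b →ₗ[ℤ] BarNatanModule L 𝒪 (i + 1) j b) : Prop :=
  (∀ (i : ℤ) (F : DkSurface L 𝒪 i j b) (y : BarNatanModule L 𝒪 (i + 1) j b),
    IsSignedSum F y → d i (cls F) = y) ∧
  ∀ i, d (i + 1) ∘ₗ d i = 0

open Classical in
/-- The differential: the unique family of maps with `d(F) = ∑ (-1)^α(c) d_c(F)`
(by convention zero if that formula did not define a unique differential). -/
def differential :
    ∀ i, BarNatanModule L 𝒪 i j b →ₗ[ℤ] BarNatanModule L 𝒪 (i + 1) j b :=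
  if h : ∃! d, IsDifferential L 𝒪 j b d then h.choose else fun _ => 0

theorem differential_comp (i : ℤ) :
    differential L 𝒪 j b (i + 1) ∘ₗ differential L 𝒪 j b i = 0 := by
  classical
  by_cases h : ∃! d, IsDifferential L 𝒪 j b d
  · simp only [differential, dif_pos h]
    exact h.choose_spec.1.2 i
  · simp [differential, dif_neg h]

/-- The Bar-Natan chain complex of `L` with the orderings `𝒪`, in the gradings `j`, `k`, `b`.
The differential raises the homological grading `i` by one. -/
def barNatanComplex : CochainComplex (ModuleCat.{0} ℤ) ℤ :=
  CochainComplex.of (fun i => ModuleCat.of ℤ (BarNatanModule L 𝒪 i j b))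
    (fun i => ModuleCat.ofHom (differential L 𝒪 j b i))
    (fun i => by rw [← ModuleCat.ofHom_comp, differential_comp]; rfl)

end Complex

/-! ### Reordering does not affect the defining conditions -/

section Reorder

variable {k : ℕ} {L : Set S3} {F : CrosscutSurface k} (σ : Equiv.Perm (Fin k))

theorem reorder_uncut : (F.reorder σ).uncut = F.uncut := by
  have h : (⋃ l, (F.reorder σ).cut l) = ⋃ l, F.cut l :=
    σ.symm.surjective.iUnion_comp fun l => F.cut l
  unfold CrosscutSurface.uncut
  rw [h]
  rfl

theorem IsDkSurface.reorder (hF : IsDkSurface L F) : IsDkSurface L (F.reorder σ) := by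
  obtain ⟨h, D, hor, w, hw, hs, hp, hf⟩ := hF
  have inj : ∀ l l' : Fin k, l ≠ l' → σ.symm l ≠ σ.symm l' := fun l l' hl => σ.symm.injective.ne hl
  refine ⟨⟨h.surface, h.boundary, fun l => h.injective _, fun l => h.cut_subset _,
    fun l => h.proper _, fun l l' hl => h.disjoint _ _ (inj l l' hl), fun p hp => ?_⟩, ?_⟩
  · rw [reorder_uncut]
    exact h.dots_subset p hp
  · let D' : FlatCoordinates (F.reorder σ) :=
      { h := D.h ∘ σ.symm
        isotopic := fun l => D.isotopic _
        disjoint := fun l l' hl => D.disjoint _ _ (inj l l' hl)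
        looks := fun l => D.looks _
        cut_eq := fun l => D.cut_eq _
        start := fun l => D.start _ }
    have e1 : D'.crossDual = D.crossDual := by
      ext p
      constructor
      · rintro (⟨h1, h2⟩ | ⟨l, hl⟩)
        · exact Or.inl ⟨h1, fun l => by simpa [D'] using h2 (σ l)⟩
        · exact Or.inr ⟨σ.symm l, hl⟩
      · rintro (⟨h1, h2⟩ | ⟨l, v, h1, h2, h3⟩)
        · exact Or.inl ⟨h1, fun l => h2 _⟩
        · refine Or.inr ⟨σ l, v, h1, ?_, ?_⟩
          · simpa [CrosscutSurface.reorder] using h2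
          · simpa [D'] using h3
    have e2 : D'.skeleton = D.skeleton := by
      have h' : (⋃ l, D'.pieceSet l) = ⋃ l, D.pieceSet l :=
        σ.symm.surjective.iUnion_comp fun l => D.pieceSet l
      unfold FlatCoordinates.skeleton
      rw [e1, h']
    exact ⟨D', by rw [e1]; exact hor, w, hw, by rw [e2]; exact hs, fun l => hp _,
      by rw [e1, e2]; exact hf⟩

theorem HasGrading.reorder {i j b : ℤ} (hF : HasGrading F i j b) :
    HasGrading (F.reorder σ) i j b := by
  have e : (F.reorder σ).numActive = F.numActive :=
    Fintype.card_congr (σ.symm.subtypeEquiv fun _ => Iff.rfl)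
  exact ⟨hF.1, hF.2.1, by rw [e]; exact hF.2.2⟩

/-- The `D^k`-surface that is the same as `F` except that its crosscuts are reordered by `σ`. -/
def DkSurface.reorder {𝒪 : Set (CrosscutSurface k)} {i j b : ℤ} (F : DkSurface L 𝒪 i j b) :
    DkSurface L (permuteOrdering σ 𝒪) i j b :=
  ⟨F.1.reorder σ, ⟨F.1, F.2.1, rfl⟩, F.2.2.1.reorder σ, F.2.2.2.reorder σ⟩

end Reorder

end Diagramless

end

open CategoryTheory

namespace Diagramless

/-! ### Reordering as a bijection that respects all relations between surfaces -/

section ReorderRelations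

variable {k : ℕ} {L : Set S3} {F G G₁ G₂ : CrosscutSurface k} (σ : Equiv.Perm (Fin k))

/-! Reordering is a bijection on surfaces that respects isotopy, the skein relations and the local
changes, so only signs are at stake. Take `ψ F = (-1)^n σF`, where `n` counts the pairs of inactive
crosscuts inverted by `σ`. This sign depends only on the activity labels, which isotopy and every
skein relation preserve, so `ψ` descends to the Bar-Natan modules (`map_relations`). For an active
`c`, let `B` be the number of inactive crosscuts before `c` that `σ` moves behind it, and `C` the
number behind `c` that move before it. Then `α(c)` changes by `C - B`, while making `c` inactive
raises `n` by `B + C`. These agree mod 2, so `ψ` carries signed sums to signed sums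
(`neg_one_pow_numInactiveBefore_reorder`, `isSignedSum_reorder_iff`). The differential is defined by
unique existence, with zero as default. Conjugation by `ψ` is a bijection between the candidate
families on the two sides (`isDifferential_conjEquiv_iff`), so both complexes fall into the same
case and `ψ` commutes with the differentials. Whether the formula defines a differential never has
to be decided. -/

theorem reorder_reorder (τ : Equiv.Perm (Fin k)) :
    (F.reorder σ).reorder τ = F.reorder (σ.trans τ) := rfl

theorem reorder_refl : F.reorder (Equiv.refl _) = F := rfl

theorem reorder_reorder_symm : (F.reorder σ).reorder σ.symm = F := by
  rw [reorder_reorder, Equiv.self_trans_symm, reorder_refl]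

theorem reorder_symm_reorder : (F.reorder σ.symm).reorder σ = F := by
  rw [reorder_reorder, Equiv.symm_trans_self, reorder_refl]

theorem reorder_dotCount (x : S3) : (F.reorder σ).dotCount x = F.dotCount x := by
  have h : (F.reorder σ).facet x = F.facet x := by
    rw [CrosscutSurface.facet, reorder_uncut, CrosscutSurface.facet]
  rw [CrosscutSurface.dotCount, h, CrosscutSurface.dotCount]
  rfl

theorem Isotopic.reorder (h : Isotopic L F G) : Isotopic L (F.reorder σ) (G.reorder σ) := by
  obtain ⟨Φ, h1, h2, h3, h4, h5, h6⟩ := h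
  refine ⟨Φ, h1, h2, fun l => h3 _, fun l => h4 _, fun l => h5 _, fun x hx => ?_⟩
  rw [reorder_uncut] at hx
  rw [reorder_dotCount, reorder_dotCount]
  exact h6 x hx

theorem HasUndottedSphere.reorder (h : HasUndottedSphere F) :
    HasUndottedSphere (F.reorder σ) := by
  obtain ⟨S, h1, h2, h3, h4, h5⟩ := h
  exact ⟨S, h1, h2, h3, fun l => h4 _, h5⟩

theorem IsUnionWithDottedSphere.reorder (h : IsUnionWithDottedSphere F G) :
    IsUnionWithDottedSphere (F.reorder σ) (G.reorder σ) := by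
  obtain ⟨S, p, h1, h2, h3, h4, h5, h6, h7⟩ := h
  exact ⟨S, p, h1, h2, h3, h4, congrArg (· ∘ σ.symm) h5, congrArg (· ∘ σ.symm) h6, h7⟩

theorem IsNeckCutting.reorder (h : IsNeckCutting F G₁ G₂) :
    IsNeckCutting (F.reorder σ) (G₁.reorder σ) (G₂.reorder σ) := by
  obtain ⟨f, h1, h2, h3, h4, h5, h6, h7, h8, h9, h10, h11, h12⟩ := h
  exact ⟨f, h1, h2, h3, h4, h5, fun l => h6 _, h7, congrArg (· ∘ σ.symm) h8,
    congrArg (· ∘ σ.symm) h9, congrArg (· ∘ σ.symm) h10, congrArg (· ∘ σ.symm) h11, h12⟩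

theorem HasTwiceDottedFacet.reorder (h : HasTwiceDottedFacet F) :
    HasTwiceDottedFacet (F.reorder σ) := by
  obtain ⟨x, hx, h2⟩ := h
  exact ⟨x, by rwa [reorder_uncut], by rwa [reorder_dotCount]⟩

/-- The same window `f` works: the crosscut at `σ c` after reordering is the old one at `c`, and the
pictures do not see positions. -/
theorem IsLocalDifferential.reorder {c : Fin k} (h : IsLocalDifferential F c G) :
    IsLocalDifferential (F.reorder σ) (σ c) (G.reorder σ) := by
  obtain ⟨h1, h2, f, h3, h4, h5, h6, h7, h8, h9, h10, h11, h12⟩ := h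
  have e : ∀ H : CrosscutSurface k, (H.reorder σ).arc (σ c) = H.arc c := fun H =>
    congrArg H.arc (σ.symm_apply_apply c)
  have e' : ∀ H : CrosscutSurface k, (H.reorder σ).cut (σ c) = H.cut c := fun H =>
    congrArg H.cut (σ.symm_apply_apply c)
  refine ⟨(congrArg F.active (σ.symm_apply_apply c)).trans h1, ?_, f, h3, h4, h5, h6,
    (e' F).trans h7, by rw [e]; exact h8, (e' G).trans h9, by rw [e]; exact h10,
    fun l hl => h11 _ fun hc => hl ?_, h12⟩
  · change G.active ∘ σ.symm = Function.update (F.active ∘ σ.symm) (σ c) false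
    rw [h2, Function.update_comp_equiv, Equiv.symm_symm]
  · rw [← hc, σ.apply_symm_apply]

/-- Here and in the following equivalences, the converse is the forward implication for `σ.symm`. -/
theorem reorder_hasUndottedSphere_iff : HasUndottedSphere (F.reorder σ) ↔ HasUndottedSphere F :=
  ⟨fun h => by simpa only [reorder_reorder_symm] using h.reorder σ.symm, fun h => h.reorder σ⟩

theorem reorder_isUnionWithDottedSphere_iff :
    IsUnionWithDottedSphere (F.reorder σ) (G.reorder σ) ↔ IsUnionWithDottedSphere F G :=
  ⟨fun h => by simpa only [reorder_reorder_symm] using h.reorder σ.symm, fun h => h.reorder σ⟩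

theorem reorder_isNeckCutting_iff :
    IsNeckCutting (F.reorder σ) (G₁.reorder σ) (G₂.reorder σ) ↔ IsNeckCutting F G₁ G₂ :=
  ⟨fun h => by simpa only [reorder_reorder_symm] using h.reorder σ.symm, fun h => h.reorder σ⟩

theorem reorder_hasTwiceDottedFacet_iff :
    HasTwiceDottedFacet (F.reorder σ) ↔ HasTwiceDottedFacet F :=
  ⟨fun h => by simpa only [reorder_reorder_symm] using h.reorder σ.symm, fun h => h.reorder σ⟩

theorem reorder_isLocalDifferential_iff {c : Fin k} :
    IsLocalDifferential (F.reorder σ) (σ c) (G.reorder σ) ↔ IsLocalDifferential F c G :=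
  ⟨fun h => by
    simpa only [reorder_reorder_symm, Equiv.symm_apply_apply] using h.reorder σ.symm,
    fun h => h.reorder σ⟩

variable (L) in
/-- Reordering, as a bijection between the `D^k`-surfaces with orderings in `𝒪` and those with
the permuted orderings. -/
def reorderEquiv (𝒪 : Set (CrosscutSurface k)) (i j b : ℤ) :
    DkSurface L 𝒪 i j b ≃ DkSurface L (permuteOrdering σ 𝒪) i j b where
  toFun F := F.reorder σ
  -- The permuted family is an image under reordering, so undoing `σ` returns to `𝒪` without any
  -- closure property of `𝒪`.
  invFun F := ⟨F.1.reorder σ.symm, by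
      obtain ⟨F₀, h, e⟩ := F.2.1
      rw [← e, reorder_reorder_symm]
      exact h, F.2.2.1.reorder σ.symm, F.2.2.2.reorder σ.symm⟩
  left_inv _ := Subtype.ext (reorder_reorder_symm σ)
  right_inv _ := Subtype.ext (reorder_symm_reorder σ)

end ReorderRelations

/-! ### The sign of a reordering -/

section Sign

variable {k : ℕ} (σ : Equiv.Perm (Fin k))

/-- The number of pairs of inactive crosscuts whose order is reversed by `σ`. -/
def numInactiveInversions (a : Fin k → Bool) : ℕ :=
  (Finset.univ.filter fun p : Fin k × Fin k =>
    p.1 < p.2 ∧ σ p.2 < σ p.1 ∧ a p.1 = false ∧ a p.2 = false).card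

/-- The sign with which a surface with the given inactive crosscuts is reordered. -/
def reorderSign (a : Fin k → Bool) : ℤ := (-1) ^ numInactiveInversions σ a

theorem reorderSign_eq_or (a : Fin k → Bool) : reorderSign σ a = 1 ∨ reorderSign σ a = -1 :=
  neg_one_pow_eq_or ℤ _

theorem reorderSign_mul_self (a : Fin k → Bool) : reorderSign σ a * reorderSign σ a = 1 := by
  rcases reorderSign_eq_or σ a with h | h <;> simp [h]

theorem reorderSign_smul_smul {M : Type*} [AddCommGroup M] (a : Fin k → Bool) (x : M) :
    reorderSign σ a • reorderSign σ a • x = x := by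
  rw [smul_smul, reorderSign_mul_self, one_smul]

/-- Making the crosscut `c` inactive creates as many inactive inversions as there are inactive
crosscuts on whose position relative to `c` the two orderings disagree. -/
theorem numInactiveInversions_update {a : Fin k → Bool} {c : Fin k} (hc : a c = true) :
    numInactiveInversions σ (Function.update a c false) = numInactiveInversions σ a +
      ((Finset.univ.filter fun l => l < c ∧ σ c < σ l ∧ a l = false).card +
       (Finset.univ.filter fun l => c < l ∧ σ l < σ c ∧ a l = false).card) := by
  -- The new inversions are exactly the inverted pairs with `c` as an entry; they are counted by
  -- their other entry, on either side of `c`.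
  have e1 : (Finset.univ.filter fun l => l < c ∧ σ c < σ l ∧ a l = false).card =
      ((Finset.univ.filter fun l => l < c ∧ σ c < σ l ∧ a l = false).image (·, c)).card :=
    (Finset.card_image_of_injective _ (Prod.mk_left_injective c)).symm
  have e2 : (Finset.univ.filter fun l => c < l ∧ σ l < σ c ∧ a l = false).card =
      ((Finset.univ.filter fun l => c < l ∧ σ l < σ c ∧ a l = false).image (c, ·)).card :=
    (Finset.card_image_of_injective _ (Prod.mk_right_injective c)).symm
  rw [e1, e2, ← Finset.card_union_of_disjoint, numInactiveInversions, numInactiveInversions,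
    ← Finset.card_union_of_disjoint]
  · congr 1
    ext ⟨x, y⟩
    simp only [Finset.mem_filter, Finset.mem_univ, true_and, Finset.mem_union, Finset.mem_image,
      Prod.mk.injEq, Function.update_apply]
    grind
  · rw [Finset.disjoint_left]
    rintro ⟨x, y⟩
    simp only [Finset.mem_filter, Finset.mem_univ, true_and, Finset.mem_union, Finset.mem_image,
      Prod.mk.injEq]
    grind
  · rw [Finset.disjoint_left]
    rintro ⟨x, y⟩
    simp only [Finset.mem_filter, Finset.mem_univ, true_and, Finset.mem_image, Prod.mk.injEq]
    grind

/-- The inactive crosscuts before `c` split according to whether `σ` keeps them before `c` or moves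
them behind it. -/
theorem numInactiveBefore_eq (F : CrosscutSurface k) (c : Fin k) :
    numInactiveBefore F c =
      (Finset.univ.filter fun l => l < c ∧ σ l < σ c ∧ F.active l = false).card +
      (Finset.univ.filter fun l => l < c ∧ σ c < σ l ∧ F.active l = false).card := by
  rw [numInactiveBefore, Fintype.card_subtype, ← Finset.card_union_of_disjoint]
  · congr 1
    ext l
    have := σ.injective.ne_iff (x := l) (y := c)
    simp only [Finset.mem_filter, Finset.mem_univ, true_and, Finset.mem_union]
    grind
  · rw [Finset.disjoint_left]
    intro l
    simp only [Finset.mem_filter, Finset.mem_univ, true_and]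
    grind

/-- The same splitting by original position. The first summand is shared with
`numInactiveBefore_eq`, so the two counts differ only in crosscuts that change sides of `c`. -/
theorem numInactiveBefore_reorder_eq {F : CrosscutSurface k} {c : Fin k}
    (hc : F.active c = true) :
    numInactiveBefore (F.reorder σ) (σ c) =
      (Finset.univ.filter fun l => l < c ∧ σ l < σ c ∧ F.active l = false).card +
      (Finset.univ.filter fun l => c < l ∧ σ l < σ c ∧ F.active l = false).card := by
  have e : numInactiveBefore (F.reorder σ) (σ c) =
      Fintype.card {l : Fin k // σ l < σ c ∧ F.active l = false} :=
    Fintype.card_congr (σ.symm.subtypeEquiv fun l => by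
      simp [CrosscutSurface.reorder])
  rw [e, Fintype.card_subtype, ← Finset.card_union_of_disjoint]
  · congr 1
    ext l
    simp only [Finset.mem_filter, Finset.mem_univ, true_and, Finset.mem_union]
    grind
  · rw [Finset.disjoint_left]
    intro l
    simp only [Finset.mem_filter, Finset.mem_univ, true_and]
    grind

/-- The sign identity behind the chain map property. With `A` crosscuts staying before `c`, and `n`,
`B`, `C` as in the overview, it reads `A + C ≡ n + (A + B) + (n + B + C)` mod 2. -/
theorem neg_one_pow_numInactiveBefore_reorder {F : CrosscutSurface k} {c : Fin k}
    (hc : F.active c = true) :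
    (-1 : ℤ) ^ numInactiveBefore (F.reorder σ) (σ c) =
      reorderSign σ F.active * ((-1) ^ numInactiveBefore F c *
        reorderSign σ (Function.update F.active c false)) := by
  rw [reorderSign, reorderSign, numInactiveInversions_update σ hc, numInactiveBefore_eq σ F c,
    numInactiveBefore_reorder_eq σ hc, ← pow_add, ← pow_add]
  exact neg_one_pow_congr (by grind)

/-- An adjacent transposition inverts only the pair of positions `m`, `m + 1`, so at most one
inversion is counted. -/
theorem reorderSign_swap {m : ℕ} (h₁ : m < k) (h₂ : m + 1 < k) (a : Fin k → Bool) :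
    reorderSign (Equiv.swap ⟨m, h₁⟩ ⟨m + 1, h₂⟩) a =
      if a ⟨m, h₁⟩ = false ∧ a ⟨m + 1, h₂⟩ = false then -1 else 1 := by
  have e : (Finset.univ.filter fun p : Fin k × Fin k =>
      p.1 < p.2 ∧ Equiv.swap (⟨m, h₁⟩ : Fin k) ⟨m + 1, h₂⟩ p.2 <
        Equiv.swap (⟨m, h₁⟩ : Fin k) ⟨m + 1, h₂⟩ p.1 ∧ a p.1 = false ∧ a p.2 = false) =
      if a ⟨m, h₁⟩ = false ∧ a ⟨m + 1, h₂⟩ = false then {(⟨m, h₁⟩, ⟨m + 1, h₂⟩)} else ∅ := by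
    ext ⟨⟨x, hx⟩, ⟨y, hy⟩⟩
    simp only [Equiv.swap_apply_def]
    split_ifs <;>
      simp only [Finset.mem_singleton, Prod.mk.injEq, Fin.mk.injEq,
        Finset.notMem_empty] <;> grind
  rw [reorderSign, numInactiveInversions, e]
  split_ifs <;> simp

end Sign

/-! ### The isomorphism -/

section Isomorphism

variable {k : ℕ} (σ : Equiv.Perm (Fin k)) (L : Set S3) (𝒪 : Set (CrosscutSurface k)) (i j b : ℤ)

/-- Reordering of isotopy classes of surfaces. -/
def reorderClassEquiv :
    Quot (fun F G : DkSurface L 𝒪 i j b => Isotopic L F.1 G.1) ≃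
      Quot (fun F G : DkSurface L (permuteOrdering σ 𝒪) i j b => Isotopic L F.1 G.1) :=
  Quot.congr (reorderEquiv L σ 𝒪 i j b) fun F G =>
    ⟨fun h => h.reorder σ, fun h => by
      have h' : Isotopic L (F.1.reorder σ) (G.1.reorder σ) := h
      simpa only [reorder_reorder_symm] using h'.reorder σ.symm⟩

/-- The sign of the reordering of an isotopy class of surfaces. -/
def reorderClassSign : Quot (fun F G : DkSurface L 𝒪 i j b => Isotopic L F.1 G.1) → ℤˣ :=
  -- Isotopic surfaces carry equal activity labels. The values are units so that they can rescale a
  -- basis in `chainEquiv`.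
  Quot.lift (fun F => (-1) ^ numInactiveInversions σ F.1.active) fun F G h => by
    obtain ⟨_, _, _, _, _, h, _⟩ := h
    rw [funext h]

/-- The signed reordering of the generators. -/
noncomputable def chainEquiv : ChainModule L 𝒪 i j b ≃ₗ[ℤ] ChainModule L (permuteOrdering σ 𝒪) i j b :=
  (Finsupp.basisSingleOne.unitsSMul (reorderClassSign σ L 𝒪 i j b)).equiv
    Finsupp.basisSingleOne (reorderClassEquiv σ L 𝒪 i j b)

variable {L 𝒪 i j b}

/-- The construction sends the rescaled basis vector `± gen F` to the reordered generator; the sign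
changes sides because it squares to one. -/
theorem chainEquiv_gen (F : DkSurface L 𝒪 i j b) :
    chainEquiv σ L 𝒪 i j b (gen F) = reorderSign σ F.1.active • gen (F.reorder σ) := by
  have h := (Finsupp.basisSingleOne.unitsSMul (reorderClassSign σ L 𝒪 i j b)).equiv_apply
    (Quot.mk _ F) Finsupp.basisSingleOne (reorderClassEquiv σ L 𝒪 i j b)
  rw [Module.Basis.unitsSMul_apply, Finsupp.coe_basisSingleOne, Finsupp.coe_basisSingleOne] at h
  have h' : reorderSign σ F.1.active • chainEquiv σ L 𝒪 i j b (gen F) = gen (F.reorder σ) := by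
    rw [← map_smul, ← show _ = gen (F.reorder σ) from h]
    simp [reorderClassSign, reorderSign, gen, chainEquiv, Units.smul_def]
  rw [← h', reorderSign_smul_smul]

theorem reorderEquiv_apply (F : DkSurface L 𝒪 i j b) :
    reorderEquiv L σ 𝒪 i j b F = F.reorder σ := rfl

theorem gen_reorder (F : DkSurface L 𝒪 i j b) :
    gen (F.reorder σ) = reorderSign σ F.1.active • chainEquiv σ L 𝒪 i j b (gen F) := by
  rw [chainEquiv_gen, reorderSign_smul_smul]

/-! ### Compatibility with the skein relations -/

theorem IsUnionWithDottedSphere.active_eq {F G : CrosscutSurface k}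
    (h : IsUnionWithDottedSphere F G) : G.active = F.active := by
  obtain ⟨_, _, _, _, _, _, _, h, _⟩ := h
  exact h

theorem IsNeckCutting.active_eq {F G₁ G₂ : CrosscutSurface k} (h : IsNeckCutting F G₁ G₂) :
    G₁.active = F.active ∧ G₂.active = F.active := by
  obtain ⟨_, _, _, _, _, _, _, _, _, _, h1, h2, _⟩ := h
  exact ⟨h1, h2⟩

/-- All surfaces in one relation have the same activity labels, hence a common sign that factors
out: each relation maps to plus or minus its reordered version. -/
theorem map_relations :
    (relations L 𝒪 i j b).map (chainEquiv σ L 𝒪 i j b : _ →ₗ[ℤ] _) =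
      relations L (permuteOrdering σ 𝒪) i j b := by
  apply le_antisymm
  · rw [relations, Submodule.map_span_le]
    rintro x (((⟨F, h, rfl⟩ | ⟨F, G, h, rfl⟩) | ⟨F, G₁, G₂, h, rfl⟩) | ⟨F, h, rfl⟩)
    · rw [LinearEquiv.coe_coe, chainEquiv_gen]
      exact Submodule.smul_mem _ _ (Submodule.subset_span
        (Or.inl (Or.inl (Or.inl ⟨F.reorder σ, h.reorder σ, rfl⟩))))
    · rw [LinearEquiv.coe_coe, map_sub, chainEquiv_gen, chainEquiv_gen, h.active_eq, ← smul_sub]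
      exact Submodule.smul_mem _ _ (Submodule.subset_span
        (Or.inl (Or.inl (Or.inr ⟨F.reorder σ, G.reorder σ, h.reorder σ, rfl⟩))))
    · rw [LinearEquiv.coe_coe, map_sub, map_sub, chainEquiv_gen, chainEquiv_gen, chainEquiv_gen,
        h.active_eq.1, h.active_eq.2, ← smul_sub, ← smul_sub]
      exact Submodule.smul_mem _ _ (Submodule.subset_span
        (Or.inl (Or.inr ⟨F.reorder σ, G₁.reorder σ, G₂.reorder σ, h.reorder σ, rfl⟩)))
    · rw [LinearEquiv.coe_coe, chainEquiv_gen]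
      exact Submodule.smul_mem _ _ (Submodule.subset_span (Or.inr ⟨F.reorder σ, h.reorder σ, rfl⟩))
  -- Every surface of the permuted family is a reordered one, so each relation there is up to sign
  -- the image of a relation for `𝒪`.
  · rw [relations, Submodule.span_le]
    have key : ∀ (n : ℤ) (x : ChainModule L 𝒪 i j b), x ∈ relations L 𝒪 i j b →
        n • chainEquiv σ L 𝒪 i j b x ∈
          (relations L 𝒪 i j b).map (chainEquiv σ L 𝒪 i j b : _ →ₗ[ℤ] _) := fun n x hx =>
      Submodule.smul_mem _ _ (Submodule.mem_map_of_mem hx)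
    rintro x (((⟨F, h, rfl⟩ | ⟨F, G, h, rfl⟩) | ⟨F, G₁, G₂, h, rfl⟩) | ⟨F, h, rfl⟩)
    · obtain ⟨F, rfl⟩ := (reorderEquiv L σ 𝒪 i j b).surjective F
      rw [reorderEquiv_apply] at h ⊢
      rw [SetLike.mem_coe, gen_reorder]
      exact key _ _ (Submodule.subset_span
        (Or.inl (Or.inl (Or.inl ⟨F, (reorder_hasUndottedSphere_iff σ).1 h, rfl⟩))))
    · obtain ⟨F, rfl⟩ := (reorderEquiv L σ 𝒪 i j b).surjective F
      obtain ⟨G, rfl⟩ := (reorderEquiv L σ 𝒪 i j b).surjective G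
      rw [reorderEquiv_apply, reorderEquiv_apply] at h ⊢
      have h' := (reorder_isUnionWithDottedSphere_iff σ).1 h
      rw [SetLike.mem_coe, gen_reorder, gen_reorder, h'.active_eq, ← smul_sub, ← map_sub]
      exact key _ _ (Submodule.subset_span (Or.inl (Or.inl (Or.inr ⟨F, G, h', rfl⟩))))
    · obtain ⟨F, rfl⟩ := (reorderEquiv L σ 𝒪 i j b).surjective F
      obtain ⟨G₁, rfl⟩ := (reorderEquiv L σ 𝒪 i j b).surjective G₁
      obtain ⟨G₂, rfl⟩ := (reorderEquiv L σ 𝒪 i j b).surjective G₂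
      rw [reorderEquiv_apply, reorderEquiv_apply, reorderEquiv_apply] at h ⊢
      have h' := (reorder_isNeckCutting_iff σ).1 h
      rw [SetLike.mem_coe, gen_reorder, gen_reorder, gen_reorder, h'.active_eq.1, h'.active_eq.2,
        ← smul_sub, ← smul_sub, ← map_sub, ← map_sub]
      exact key _ _ (Submodule.subset_span (Or.inl (Or.inr ⟨F, G₁, G₂, h', rfl⟩)))
    · obtain ⟨F, rfl⟩ := (reorderEquiv L σ 𝒪 i j b).surjective F
      rw [reorderEquiv_apply] at h ⊢
      rw [SetLike.mem_coe, gen_reorder]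
      exact key _ _ (Submodule.subset_span
        (Or.inr ⟨F, (reorder_hasTwiceDottedFacet_iff σ).1 h, rfl⟩))

variable (L 𝒪 i j b) in
/-- The signed reordering on the Bar-Natan chain modules. -/
noncomputable def barNatanEquiv :
    BarNatanModule L 𝒪 i j b ≃ₗ[ℤ] BarNatanModule L (permuteOrdering σ 𝒪) i j b :=
  Submodule.Quotient.equiv _ _ (chainEquiv σ L 𝒪 i j b) (map_relations σ)

theorem barNatanEquiv_cls (F : DkSurface L 𝒪 i j b) :
    barNatanEquiv σ L 𝒪 i j b (cls F) = reorderSign σ F.1.active • cls (F.reorder σ) := by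
  have h : barNatanEquiv σ L 𝒪 i j b (cls F) =
      (relations L (permuteOrdering σ 𝒪) i j b).mkQ (chainEquiv σ L 𝒪 i j b (gen F)) := rfl
  rw [h, chainEquiv_gen, map_smul]
  rfl

/-! ### Compatibility with the differential -/

theorem sum_cls_reorder (F : DkSurface L 𝒪 i j b)
    (G : {c : Fin k // F.1.active c = true} → DkSurface L 𝒪 (i + 1) j b)
    (hG : ∀ c, IsLocalDifferential F.1 c.1 (G c).1)
    (G' : {c : Fin k // (F.reorder σ).1.active c = true} →
      DkSurface L (permuteOrdering σ 𝒪) (i + 1) j b)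
    (e : {c : Fin k // F.1.active c = true} ≃ {c : Fin k // (F.reorder σ).1.active c = true})
    (he : ∀ c, (e c).1 = σ c.1) (hG' : ∀ c, G' (e c) = (G c).reorder σ) :
    ∑ c, (-1 : ℤ) ^ numInactiveBefore (F.reorder σ).1 c.1 • cls (G' c) =
      reorderSign σ F.1.active • barNatanEquiv σ L 𝒪 (i + 1) j b
        (∑ c, (-1 : ℤ) ^ numInactiveBefore F.1 c.1 • cls (G c)) := by
  rw [map_sum, Finset.smul_sum]
  -- Matching the summand at `c` with the one at `σ c` leaves only the sign identity, where the
  -- labels of `G c` are those of `F` with `c` made inactive.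
  refine (Fintype.sum_equiv e _ _ fun c => ?_).symm
  rw [hG', he, map_smul, barNatanEquiv_cls, (hG c).2.1, smul_smul, smul_smul]
  congr 1
  rw [mul_assoc]
  exact (neg_one_pow_numInactiveBefore_reorder σ c.2).symm

/-- The signed reordering takes the signed sums for `F` to those for the reordered surface. -/
theorem isSignedSum_reorder_iff (F : DkSurface L 𝒪 i j b)
    (y : BarNatanModule L 𝒪 (i + 1) j b) :
    IsSignedSum (F.reorder σ) (reorderSign σ F.1.active • barNatanEquiv σ L 𝒪 (i + 1) j b y) ↔
      IsSignedSum F y := by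
  have hcond : ∀ c, F.1.active c = true ↔ (F.reorder σ).1.active (σ c) = true := fun c => by
    simp [DkSurface.reorder, CrosscutSurface.reorder]
  let e : {c : Fin k // F.1.active c = true} ≃ {c : Fin k // (F.reorder σ).1.active c = true} :=
    σ.subtypeEquiv hcond
  have he : ∀ c, (e c).1 = σ c.1 := fun _ => rfl
  constructor
  · rintro ⟨G', h, hy⟩
    -- A signed sum involves a choice of results of the local changes; this choice is pulled back
    -- along the reordering.
    let G := fun c => (reorderEquiv L σ 𝒪 (i + 1) j b).symm (G' (e c))
    have hG' : ∀ c, G' (e c) = (G c).reorder σ := fun c =>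
      ((reorderEquiv L σ 𝒪 (i + 1) j b).apply_symm_apply _).symm
    have hG : ∀ c, IsLocalDifferential F.1 c.1 (G c).1 := fun c => by
      have := h (e c)
      rw [hG'] at this
      exact (reorder_isLocalDifferential_iff σ).1 this
    refine ⟨G, hG, (barNatanEquiv σ L 𝒪 (i + 1) j b).injective ?_⟩
    rw [sum_cls_reorder σ F G hG G' e he hG'] at hy
    rw [← reorderSign_smul_smul σ F.1.active (barNatanEquiv σ L 𝒪 (i + 1) j b y), hy,
      reorderSign_smul_smul]
  · rintro ⟨G, h, rfl⟩
    have hG' : ∀ c, (fun c' => (G (e.symm c')).reorder σ) (e c) = (G c).reorder σ := fun c => by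
      simp only [Equiv.symm_apply_apply]
    refine ⟨fun c' => (G (e.symm c')).reorder σ, fun c' => ?_,
      (sum_cls_reorder σ F G h _ e he hG').symm⟩
    obtain ⟨c, rfl⟩ := e.surjective c'
    rw [hG', he]
    exact (h c).reorder σ

variable (L 𝒪 j b) in
/-- Conjugation by the signed reordering. -/
noncomputable def conjEquiv :
    (∀ i, BarNatanModule L 𝒪 i j b →ₗ[ℤ] BarNatanModule L 𝒪 (i + 1) j b) ≃
      (∀ i, BarNatanModule L (permuteOrdering σ 𝒪) i j b →ₗ[ℤ]
        BarNatanModule L (permuteOrdering σ 𝒪) (i + 1) j b) :=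
  Equiv.piCongrRight fun i =>
    ((barNatanEquiv σ L 𝒪 i j b).arrowCongr (barNatanEquiv σ L 𝒪 (i + 1) j b)).toEquiv

theorem conjEquiv_apply
    (d : ∀ i, BarNatanModule L 𝒪 i j b →ₗ[ℤ] BarNatanModule L 𝒪 (i + 1) j b)
    (x : BarNatanModule L 𝒪 i j b) :
    conjEquiv σ L 𝒪 j b d i (barNatanEquiv σ L 𝒪 i j b x) =
      barNatanEquiv σ L 𝒪 (i + 1) j b (d i x) := by
  simp [conjEquiv, LinearEquiv.arrowCongr_apply]

/-- Signed sums correspond under the signed reordering, and conjugation by an isomorphism preserves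
and reflects `d ∘ d = 0`. -/
theorem isDifferential_conjEquiv_iff
    (d : ∀ i, BarNatanModule L 𝒪 i j b →ₗ[ℤ] BarNatanModule L 𝒪 (i + 1) j b) :
    IsDifferential L (permuteOrdering σ 𝒪) j b (conjEquiv σ L 𝒪 j b d) ↔
      IsDifferential L 𝒪 j b d := by
  have hcls : ∀ (i : ℤ) (F : DkSurface L 𝒪 i j b),
      conjEquiv σ L 𝒪 j b d i (cls (F.reorder σ)) =
        reorderSign σ F.1.active • barNatanEquiv σ L 𝒪 (i + 1) j b (d i (cls F)) := fun i F => by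
    rw [← conjEquiv_apply, barNatanEquiv_cls, map_smul, reorderSign_smul_smul]
  refine and_congr ⟨fun h i F y hy => ?_, fun h i F y hy => ?_⟩
    (forall_congr' fun i => ⟨fun h => ?_, fun h => ?_⟩)
  · have h1 := h i (F.reorder σ) _ ((isSignedSum_reorder_iff σ F y).2 hy)
    rw [hcls] at h1
    apply (barNatanEquiv σ L 𝒪 (i + 1) j b).injective
    rw [← reorderSign_smul_smul σ F.1.active (barNatanEquiv σ L 𝒪 (i + 1) j b (d i (cls F))), h1,
      reorderSign_smul_smul]
  · obtain ⟨F, rfl⟩ := (reorderEquiv L σ 𝒪 i j b).surjective F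
    rw [reorderEquiv_apply] at hy ⊢
    obtain ⟨x, hx⟩ := (barNatanEquiv σ L 𝒪 (i + 1) j b).surjective
      (reorderSign σ F.1.active • y)
    have hx' : y = reorderSign σ F.1.active • barNatanEquiv σ L 𝒪 (i + 1) j b x := by
      rw [hx, reorderSign_smul_smul]
    rw [hx', isSignedSum_reorder_iff] at hy
    rw [hcls, h i F x hy, hx']
  · refine LinearMap.ext fun x => ?_
    apply (barNatanEquiv σ L 𝒪 (i + 1 + 1) j b).injective
    have := LinearMap.congr_fun h (barNatanEquiv σ L 𝒪 i j b x)
    rw [LinearMap.comp_apply, conjEquiv_apply, conjEquiv_apply] at this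
    rw [LinearMap.comp_apply, this, LinearMap.zero_apply, LinearMap.zero_apply, map_zero]
  · refine LinearMap.ext fun x => ?_
    obtain ⟨x, rfl⟩ := (barNatanEquiv σ L 𝒪 i j b).surjective x
    rw [LinearMap.comp_apply, conjEquiv_apply, conjEquiv_apply, ← LinearMap.comp_apply, h,
      LinearMap.zero_apply, LinearMap.zero_apply, map_zero]

/-- Conjugation transports unique existence. If it holds, uniqueness identifies the two
differentials; otherwise both are the default zero, which conjugation preserves. -/
theorem differential_permuteOrdering :
    differential L (permuteOrdering σ 𝒪) j b = conjEquiv σ L 𝒪 j b (differential L 𝒪 j b) := by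
  have hiff : (∃! d, IsDifferential L 𝒪 j b d) ↔
      ∃! d, IsDifferential L (permuteOrdering σ 𝒪) j b d :=
    (conjEquiv σ L 𝒪 j b).existsUnique_congr fun {d} => (isDifferential_conjEquiv_iff σ d).symm
  by_cases h : ∃! d, IsDifferential L 𝒪 j b d
  · have h' := hiff.1 h
    rw [differential, differential, dif_pos h, dif_pos h']
    exact h'.unique h'.choose_spec.1 ((isDifferential_conjEquiv_iff σ _).2 h.choose_spec.1)
  · have h' := mt hiff.2 h
    rw [differential, differential, dif_neg h, dif_neg h']
    funext i
    simp [conjEquiv]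

variable (L 𝒪 j b) in
/-- The signed reordering, as an isomorphism of Bar-Natan complexes. -/
noncomputable def barNatanComplexIso :
    barNatanComplex L 𝒪 j b ≅ barNatanComplex L (permuteOrdering σ 𝒪) j b :=
  HomologicalComplex.Hom.isoOfComponents
    (fun i => (barNatanEquiv σ L 𝒪 i j b).toModuleIso) fun i i' (h : i + 1 = i') => by
      -- With the target index literally `i + 1`, `CochainComplex.of_d` exposes the differential.
      subst h
      ext x
      simp only [barNatanComplex, CochainComplex.of_d, differential_permuteOrdering]
      exact conjEquiv_apply σ _ x

end Isomorphism

end Diagramless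

theorem mainTheorem5 (k : ℕ) (L : Set Diagramless.S3) (hL : Diagramless.IsLink L)
    (𝒪 : Set (Diagramless.CrosscutSurface k)) (h𝒪 : Diagramless.IsOrderingFamily L 𝒪)
    (j b : ℤ) :
    (∀ σ : Equiv.Perm (Fin k),
      ∃ ψ : Diagramless.barNatanComplex L 𝒪 j b ≅
          Diagramless.barNatanComplex L (Diagramless.permuteOrdering σ 𝒪) j b,
        ∀ (i : ℤ) (F : Diagramless.DkSurface L 𝒪 i j b), ∃ ε : ℤ, (ε = 1 ∨ ε = -1) ∧
          (ψ.hom.f i).hom (Diagramless.cls F) = ε • Diagramless.cls (F.reorder σ) ∧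
          ∀ y : Diagramless.BarNatanModule L 𝒪 (i + 1) j b, Diagramless.IsSignedSum F y →
            Diagramless.IsSignedSum (F.reorder σ) (ε • (ψ.hom.f (i + 1)).hom y)) ∧
    (∀ (m : ℕ) (h₁ : m < k) (h₂ : m + 1 < k) (σ : Equiv.Perm (Fin k)),
      σ = Equiv.swap ⟨m, h₁⟩ ⟨m + 1, h₂⟩ →
      ∃ ψ : Diagramless.barNatanComplex L 𝒪 j b ≅
          Diagramless.barNatanComplex L (Diagramless.permuteOrdering σ 𝒪) j b,
        ∀ (i : ℤ) (F : Diagramless.DkSurface L 𝒪 i j b) (ε : ℤ),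
          ε = (if F.1.active ⟨m, h₁⟩ = false ∧ F.1.active ⟨m + 1, h₂⟩ = false
            then -1 else 1) →
          (ψ.hom.f i).hom (Diagramless.cls F) = ε • Diagramless.cls (F.reorder σ) ∧
          ∀ y : Diagramless.BarNatanModule L 𝒪 (i + 1) j b, Diagramless.IsSignedSum F y →
            Diagramless.IsSignedSum (F.reorder σ) (ε • (ψ.hom.f (i + 1)).hom y)) := by
  refine ⟨fun σ => ⟨Diagramless.barNatanComplexIso σ L 𝒪 j b, fun i F =>
    ⟨Diagramless.reorderSign σ F.1.active, Diagramless.reorderSign_eq_or σ _,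
      Diagramless.barNatanEquiv_cls σ F, fun y hy =>
        (Diagramless.isSignedSum_reorder_iff σ F y).2 hy⟩⟩, ?_⟩
  rintro m h₁ h₂ σ rfl
  -- The general isomorphism also serves here; only its sign has to be evaluated.
  refine ⟨Diagramless.barNatanComplexIso _ L 𝒪 j b, fun i F ε hε => ?_⟩
  rw [← Diagramless.reorderSign_swap h₁ h₂] at hε
  subst hε
  exact ⟨Diagramless.barNatanEquiv_cls _ F, fun y hy =>
    (Diagramless.isSignedSum_reorder_iff _ F y).2 hy⟩
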